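/- Consider a wireless network with one transmitter–receiver pair and $R$ parallel amplify-and-forward relays. The channels $f_r$ (transmitter to relay $r$) and $g_r$ (relay $r$ to receiver), $r=1,\dots,R$, are independent with $f_r\sim\mathcal{CN}(0,\sigma_{f_r}^2)$, $g_r\sim\mathcal{CN}(0,\sigma_{g_r}^2)$, and the power constraints of the transmitter and of relay $r$ are $P_0=p_0P$ and $P_r=p_rP$, where $\sigma_{f_r},\sigma_{g_r},p_0,p_r>0$ are fixed and $P>0$ varies. For a beamforming vector $\mathbf{x}\in\mathbb{C}^R$ and a channel state $\mathbf{h}=(f_1,g_1,\dots,f_R,g_R)$ put $$\mathrm{SNR}_P(\mathbf{x},\mathbf{h})=\frac{P_0\left|\sum_{r=1}^R x_rf_rg_r\sqrt{\rho_r}\right|^2}{1+\sum_{r=1}^R|x_r|^2|g_r|^2\rho_r},\qquad \rho_r=\frac{P_r}{1+|f_r|^2P_0}.$$ Let $\mathcal{C}\subset\{\mathbf{x}\in\mathbb{C}^R:|x_r|\le 1\ \text{for all } r\}$ be a nonempty finite power-independent codebook, used with the optimal quantizer $\mathcal{Q}_P(\mathbf{h})\in\arg\max_{\mathbf{x}\in\mathcal{C}}\mathrm{SNR}_P(\mathbf{x},\mathbf{h})$,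 and let $$\mathrm{SER}_P(\mathcal{C})=\mathrm{E}_{\mathbf{h}}\left[\mathrm{Q}\left(\sqrt{2\,\mathrm{SNR}_P(\mathcal{Q}_P(\mathbf{h}),\mathbf{h})}\right)\right]$$ be its symbol error rate for binary signalling, where $\mathrm{Q}$ is the Gaussian tail function. Suppose that $|\mathcal{C}|\le R$ and that $\mathcal{C}$ is diversity-optimal, i.e. it achieves diversity $|\mathcal{C}|$: $$\lim_{P\to\infty}-\frac{\log\mathrm{SER}_P(\mathcal{C})}{\log P}=|\mathcal{C}|.$$ Then $\mathcal{C}$ is an orthogonal multiple-relay selection (OMRS) codebook: $\sum_{r=1}^R|x_r||y_r|=0$ for all distinct $\mathbf{x},\mathbf{y}\in\mathcal{C}$. -/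

import Mathlib

open MeasureTheory ProbabilityTheory Filter Topology
open scoped NNReal

noncomputable section

/-- The circularly symmetric complex Gaussian law `CN(0, v)`: independent real and imaginary parts,
each centred Gaussian with variance `v / 2`. -/
def complexGaussian (v : ℝ≥0) : Measure ℂ :=
  ((gaussianReal 0 (v / 2)).prod (gaussianReal 0 (v / 2))).map Complex.measurableEquivRealProd.symm

/-- The Gaussian tail function `Q(t) = Pr[N(0,1) > t]`. -/
def gaussianTail (t : ℝ) : ℝ := (gaussianReal 0 1).real (Set.Ioi t)

/-- The fixed parameters of a network with one transmitter-receiver pair and `R` parallel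
amplify-and-forward relays: the power scalers `p₀` (transmitter) and `p r` (relay `r`), and the
standard deviations of the channels `f r` (transmitter to relay) and `g r` (relay to receiver). -/
structure RelayNetwork (R : ℕ) where
  p₀ : ℝ
  p : Fin R → ℝ
  σf : Fin R → ℝ≥0
  σg : Fin R → ℝ≥0
  p₀_pos : 0 < p₀
  p_pos : ∀ r, 0 < p r
  σf_pos : ∀ r, 0 < σf r
  σg_pos : ∀ r, 0 < σg r

/-- A channel state: the pair `(f r, g r)` for each relay `r`. -/
abbrev ChannelState (R : ℕ) : Type := Fin R → ℂ × ℂ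

/-- A finite power-independent codebook: a finite nonempty set of beamforming vectors, all of which
satisfy the short-term power constraint `|x r| ≤ 1`. -/
structure ICodebook (R : ℕ) where
  vectors : Finset (Fin R → ℂ)
  nonempty : vectors.Nonempty
  norm_le_one : ∀ x ∈ vectors, ∀ r, ‖x r‖ ≤ 1

/-- The cardinality of a codebook. -/
def ICodebook.card {R : ℕ} (C : ICodebook R) : ℕ := C.vectors.card

/-- Orthogonal multiple-relay selection (for a one-element codebook the condition is vacuous). -/
def ICodebook.IsOMRS {R : ℕ} (C : ICodebook R) : Prop :=
  ∀ x ∈ C.vectors, ∀ y ∈ C.vectors, y ≠ x → ∑ r, ‖x r‖ * ‖y r‖ = 0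

namespace RelayNetwork

variable {R : ℕ} (N : RelayNetwork R)

/-- All `2 R` channels are independent, `f r ∼ CN(0, σf r ^ 2)` and `g r ∼ CN(0, σg r ^ 2)`. -/
def channelLaw : Measure (ChannelState R) :=
  Measure.pi fun r => (complexGaussian (N.σf r ^ 2)).prod (complexGaussian (N.σg r ^ 2))

/-- The relay normalization factor `ρ r = P_r / (1 + |f r|² P₀)`, with `P₀ = p₀ P`, `P_r = p r P`. -/
def rho (P : ℝ) (h : ChannelState R) (r : Fin R) : ℝ :=
  N.p r * P / (1 + ‖(h r).1‖ ^ 2 * (N.p₀ * P))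

/-- The received signal-to-noise ratio. -/
def snr (P : ℝ) (x : Fin R → ℂ) (h : ChannelState R) : ℝ :=
  N.p₀ * P * ‖∑ r, x r * (h r).1 * (h r).2 * (Real.sqrt (N.rho P h r) : ℂ)‖ ^ 2 /
    (1 + ∑ r, ‖x r‖ ^ 2 * ‖(h r).2‖ ^ 2 * N.rho P h r)

/-- The symbol error rate, for binary signalling, of a quantizer `q` at power level `P`. -/
def ser (P : ℝ) (q : ChannelState R → Fin R → ℂ) : ℝ :=
  ∫ h, gaussianTail (Real.sqrt (2 * N.snr P (q h) h)) ∂N.channelLaw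

/-- The optimal quantizer of a codebook at power level `P`: it picks a codebook vector that
maximizes the signal-to-noise ratio. -/
def optimalQuantizer (C : ICodebook R) (P : ℝ) (h : ChannelState R) : Fin R → ℂ :=
  (C.vectors.exists_max_image (fun x => N.snr P x h) C.nonempty).choose

theorem optimalQuantizer_mem (C : ICodebook R) (P : ℝ) (h : ChannelState R) :
    N.optimalQuantizer C P h ∈ C.vectors :=
  (C.vectors.exists_max_image (fun x => N.snr P x h) C.nonempty).choose_spec.1

theorem snr_le_snr_optimalQuantizer (C : ICodebook R) (P : ℝ) (h : ChannelState R)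
    (x : Fin R → ℂ) (hx : x ∈ C.vectors) :
    N.snr P x h ≤ N.snr P (N.optimalQuantizer C P h) h :=
  (C.vectors.exists_max_image (fun x => N.snr P x h) C.nonempty).choose_spec.2 x hx

/-- The codebook `C` achieves diversity `d`: with its optimal quantizers,
`- log SER_P / log P` converges to `d` as `P → ∞`. -/
def HasDiversity (C : ICodebook R) (d : ℝ) : Prop :=
  Tendsto (fun P : ℝ => -Real.log (N.ser P (N.optimalQuantizer C P)) / Real.log P) atTop (𝓝 d)

end RelayNetwork

end

/-! Contrapositive. Choose one active relay for each nonzero codeword, using the same relay for two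
codewords that share one: the chosen set `T` has fewer than `C.card` elements
(`exists_hitting_set`). With probability at least of order `P⁻¹ ^ T.card`, every relay in `T` has
`‖f‖² = O(1/P)` while all `g` have moderate size. Each nonzero codeword then uses a relay that
amplifies noise to order `P`, and no signal ever exceeds order `P`, so every SNR is bounded
(`exists_snr_le_on_deafRelays`) and the error probability stays away from zero. Hence the diversity
is at most `T.card` (`HasDiversity.le_of_hitting_set`). -/

theorem gaussianReal_real_Icc_ge {v : ℝ≥0} (hv : v ≠ 0) :
    ∃ c : ℝ, 0 < c ∧ ∀ a b : ℝ, -2 ≤ a → a ≤ b → b ≤ 2 →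
      c * (b - a) ≤ (gaussianReal 0 v).real (Set.Icc a b) := by
  -- On `[-2, 2]` the centred density is smallest at the endpoints.
  refine ⟨gaussianPDFReal 0 v 2, gaussianPDFReal_pos 0 v 2 hv, fun a b ha hab hb => ?_⟩
  rw [measureReal_def, gaussianReal_apply_eq_integral 0 hv,
    ENNReal.toReal_ofReal (setIntegral_nonneg measurableSet_Icc
      fun x _ => gaussianPDFReal_nonneg 0 v x)]
  have hconst : gaussianPDFReal 0 v 2 * (b - a) = ∫ _ in Set.Icc a b, gaussianPDFReal 0 v 2 := by
    simp [hab, mul_comm]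
  rw [hconst]
  refine setIntegral_mono_on (by simp) (integrable_gaussianPDFReal 0 v).integrableOn
    measurableSet_Icc fun x hx => ?_
  have hx2 : x ^ 2 ≤ 2 ^ 2 := sq_le_sq' (ha.trans hx.1) (hx.2.trans hb)
  simp only [gaussianPDFReal, sub_zero]
  gcongr

instance isProbabilityMeasure_complexGaussian (v : ℝ≥0) :
    IsProbabilityMeasure (complexGaussian v) :=
  Measure.isProbabilityMeasure_map Complex.measurableEquivRealProd.symm.measurable.aemeasurable

theorem complexGaussian_real_reProdIm (v : ℝ≥0) (s t : Set ℝ) :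
    (complexGaussian v).real (s ×ℂ t) =
      (gaussianReal 0 (v / 2)).real s * (gaussianReal 0 (v / 2)).real t := by
  rw [← measureReal_prod_prod, complexGaussian, measureReal_def, MeasurableEquiv.map_apply,
    measureReal_def]
  rfl

theorem complexGaussian_real_rectangle_ge {v : ℝ≥0} (hv : v ≠ 0) :
    ∃ c : ℝ, 0 < c ∧ ∀ a b a' b' : ℝ, -2 ≤ a → a ≤ b → b ≤ 2 → -2 ≤ a' → a' ≤ b' → b' ≤ 2 →
      c * ((b - a) * (b' - a')) ≤ (complexGaussian v).real (Set.Icc a b ×ℂ Set.Icc a' b') := by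
  obtain ⟨c, hc, h⟩ := gaussianReal_real_Icc_ge (v := v / 2) (by positivity)
  refine ⟨c * c, by positivity, fun a b a' b' h1 h2 h3 h4 h5 h6 => ?_⟩
  rw [complexGaussian_real_reProdIm, mul_mul_mul_comm]
  have := sub_nonneg.2 h5
  exact mul_le_mul (h _ _ h1 h2 h3) (h _ _ h4 h5 h6) (by positivity) measureReal_nonneg

theorem complexGaussian_real_annulus_pos {v : ℝ≥0} (hv : v ≠ 0) :
    0 < (complexGaussian v).real {z | 1 ≤ ‖z‖ ∧ ‖z‖ ≤ 2} := by
  obtain ⟨c, hc, h⟩ := complexGaussian_real_rectangle_ge hv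
  have key := h 1 (3 / 2) 0 (1 / 2) (by norm_num) (by norm_num) (by norm_num) (by norm_num)
    (by norm_num) (by norm_num)
  refine lt_of_lt_of_le (by norm_num [hc]) (key.trans (measureReal_mono fun z hz => ?_))
  obtain ⟨⟨h1, h2⟩, h3, h4⟩ := hz
  refine ⟨h1.trans (Complex.re_le_norm z), (Complex.norm_le_abs_re_add_abs_im z).trans ?_⟩
  rw [abs_of_nonneg (by linarith), abs_of_nonneg h3]
  linarith

theorem complexGaussian_real_disc_ge {v : ℝ≥0} (hv : v ≠ 0) :
    ∃ c : ℝ, 0 < c ∧ ∀ t : ℝ, 1 ≤ t → c * t⁻¹ ≤ (complexGaussian v).real {z | ‖z‖ ^ 2 * t ≤ 1} := by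
  obtain ⟨c, hc, h⟩ := complexGaussian_real_rectangle_ge hv
  refine ⟨c, hc, fun t ht => ?_⟩
  have ht0 : 0 < t := by linarith
  have hs0 : 0 < Real.sqrt t⁻¹ := by positivity
  have hs : Real.sqrt t⁻¹ * Real.sqrt t⁻¹ = t⁻¹ := Real.mul_self_sqrt (by positivity)
  have hs1 : Real.sqrt t⁻¹ ≤ 1 := Real.sqrt_le_one.2 (inv_le_one_of_one_le₀ ht)
  set s := Real.sqrt t⁻¹
  -- The square of side `s` lies in the disc of radius `s`, and its area is `t⁻¹`.
  have key := h (-(s / 2)) (s / 2) (-(s / 2)) (s / 2) (by linarith) (by linarith) (by linarith)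
    (by linarith) (by linarith) (by linarith)
  rw [show (s / 2 - -(s / 2)) * (s / 2 - -(s / 2)) = s * s by ring, hs] at key
  refine key.trans (measureReal_mono fun z hz => ?_)
  obtain ⟨hre, him⟩ := hz
  have hz : ‖z‖ ≤ s :=
    (Complex.norm_le_abs_re_add_abs_im z).trans (by linarith [abs_le.2 hre, abs_le.2 him])
  calc ‖z‖ ^ 2 * t ≤ s ^ 2 * t := by gcongr
    _ = 1 := by rw [sq, hs, inv_mul_cancel₀ ht0.ne']

theorem gaussianTail_antitone : Antitone gaussianTail := fun _ _ h =>
  measureReal_mono (Set.Ioi_subset_Ioi h)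

theorem gaussianTail_pos (t : ℝ) : 0 < gaussianTail t := by
  rw [gaussianTail, measureReal_def, gaussianReal_apply_eq_integral 0 one_ne_zero,
    ENNReal.toReal_ofReal (setIntegral_nonneg measurableSet_Ioi
      fun x _ => gaussianPDFReal_nonneg 0 1 x)]
  rw [setIntegral_pos_iff_support_of_nonneg_ae
    (Eventually.of_forall fun x => gaussianPDFReal_nonneg 0 1 x)
    (integrable_gaussianPDFReal 0 1).integrableOn]
  have hsupp : Function.support (gaussianPDFReal 0 1) = Set.univ :=
    Set.eq_univ_of_forall fun x => (gaussianPDFReal_pos 0 1 x one_ne_zero).ne'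
  simp [hsupp]

/-! ### Hitting sets of relays -/

namespace ICodebook

variable {R : ℕ}

/-- Two codewords with a common active relay allow a set of fewer than `C.card` relays to meet the
support of every nonzero codeword. -/
theorem exists_hitting_set (C : ICodebook R) {x y : Fin R → ℂ} (hx : x ∈ C.vectors)
    (hy : y ∈ C.vectors) (hxy : y ≠ x) {r₀ : Fin R} (hxr : x r₀ ≠ 0) (hyr : y r₀ ≠ 0) :
    ∃ T : Finset (Fin R), T.card < C.card ∧ ∀ z ∈ C.vectors, z ≠ 0 → ∃ r ∈ T, z r ≠ 0 := by
  classical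
  have hφ : ∀ z : Fin R → ℂ, ∃ r, (z r₀ ≠ 0 → r = r₀) ∧ (z ≠ 0 → z r ≠ 0) := by
    intro z
    by_cases h : z r₀ = 0
    · by_cases h0 : z = 0
      · exact ⟨r₀, by simp [h0]⟩
      · obtain ⟨r, hr⟩ := Function.ne_iff.1 h0
        exact ⟨r, fun h' => (h' h).elim, fun _ => hr⟩
    · exact ⟨r₀, fun _ => rfl, fun _ => h⟩
  choose φ hφ₁ hφ₂ using hφ
  refine ⟨C.vectors.image φ, ?_, fun z hz h0 => ⟨φ z, Finset.mem_image_of_mem _ hz, hφ₂ z h0⟩⟩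
  -- Equal cardinalities would make `φ` injective on the codebook, yet `x` and `y` both go to `r₀`.
  refine lt_of_le_of_ne Finset.card_image_le fun h => hxy ?_
  exact Finset.card_image_iff.1 h hy hx ((hφ₁ y hyr).trans (hφ₁ x hxr).symm)

end ICodebook

/-! ### The deaf-relay event and the error rate -/

namespace RelayNetwork

variable {R : ℕ} (N : RelayNetwork R)

instance isProbabilityMeasure_channelLaw : IsProbabilityMeasure N.channelLaw := by
  unfold channelLaw
  infer_instance

/-- The channel states for which the relays in `T` barely hear the transmitter, while the
channels to the receiver are of moderate size. -/
def deafRelays (T : Finset (Fin R)) (P : ℝ) : Set (ChannelState R) :=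
  Set.univ.pi fun r =>
    {f : ℂ | r ∈ T → ‖f‖ ^ 2 * (N.p₀ * P) ≤ 1} ×ˢ {g : ℂ | 1 ≤ ‖g‖ ∧ ‖g‖ ≤ 2}

theorem measurableSet_deafRelays (T : Finset (Fin R)) (P : ℝ) :
    MeasurableSet (N.deafRelays T P) := by
  refine MeasurableSet.univ_pi fun r => MeasurableSet.prod ?_ ?_
  · by_cases h : r ∈ T
    · simp only [h, true_imp_iff]
      exact measurableSet_le (f := fun z : ℂ => ‖z‖ ^ 2 * (N.p₀ * P)) (by fun_prop)
        measurable_const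
    · simp [h]
  · exact (measurableSet_le measurable_const measurable_norm).inter
      (measurableSet_le measurable_norm measurable_const)

theorem channelLaw_real_deafRelays_ge (T : Finset (Fin R)) :
    ∃ c : ℝ, 0 < c ∧ ∀ P : ℝ, 1 ≤ N.p₀ * P →
      c * P⁻¹ ^ T.card ≤ N.channelLaw.real (N.deafRelays T P) := by
  have hσf r : N.σf r ^ 2 ≠ 0 := pow_ne_zero _ (N.σf_pos r).ne'
  have hσg r : N.σg r ^ 2 ≠ 0 := pow_ne_zero _ (N.σg_pos r).ne'
  choose a ha hdisc using fun r => complexGaussian_real_disc_ge (hσf r)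
  set b : Fin R → ℝ := fun r => (complexGaussian (N.σg r ^ 2)).real {z | 1 ≤ ‖z‖ ∧ ‖z‖ ≤ 2}
  have hb r : 0 < b r := complexGaussian_real_annulus_pos (hσg r)
  have hp := N.p₀_pos
  refine ⟨(∏ r ∈ T, a r * N.p₀⁻¹) * ∏ r, b r,
    mul_pos (Finset.prod_pos fun r _ => mul_pos (ha r) (inv_pos.2 hp))
      (Finset.prod_pos fun r _ => hb r), fun P hP => ?_⟩
  have hP0 : 0 < P := pos_of_mul_pos_right (by linarith) hp.le
  have hprod : N.channelLaw.real (N.deafRelays T P) =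
      (∏ r, (complexGaussian (N.σf r ^ 2)).real
        {f : ℂ | r ∈ T → ‖f‖ ^ 2 * (N.p₀ * P) ≤ 1}) * ∏ r, b r := by
    rw [← Finset.prod_mul_distrib, measureReal_def, channelLaw, deafRelays, Measure.pi_pi, ENNReal.toReal_prod]
    exact Finset.prod_congr rfl fun r _ => measureReal_prod_prod _ _
  -- Relays outside `T` have unconstrained `f`, hence contribute the factor 1.
  have hT : ∏ r ∈ T, a r * N.p₀⁻¹ * P⁻¹ = ∏ r, if r ∈ T then a r * N.p₀⁻¹ * P⁻¹ else 1 := by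
    simp
  rw [hprod, mul_right_comm, Finset.prod_mul_pow_card, hT]
  refine mul_le_mul_of_nonneg_right (Finset.prod_le_prod (fun r _ => ?_) fun r _ => ?_)
    (Finset.prod_nonneg fun r _ => (hb r).le)
  · have := ha r
    split_ifs <;> positivity
  · split_ifs with h
    · simpa [h, mul_assoc, mul_comm P⁻¹] using hdisc r (N.p₀ * P) hP
    · simp [h]

theorem rho_nonneg {P : ℝ} (hP : 0 < P) (h : ChannelState R) (r : Fin R) : 0 ≤ N.rho P h r := by
  have := N.p_pos r
  have := N.p₀_pos
  unfold rho
  positivity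

/-- The normalization caps each relay's forwarded signal amplitude independently of `f` and `P`,
since `1 + ‖f‖² P₀ ≥ ‖f‖² P₀`. -/
theorem norm_mul_sqrt_rho_le {P : ℝ} (hP : 0 < P) (h : ChannelState R) (r : Fin R) :
    ‖(h r).1‖ * Real.sqrt (N.rho P h r) ≤ Real.sqrt (N.p r / N.p₀) := by
  have := N.p_pos r
  have hp := N.p₀_pos
  refine Real.le_sqrt_of_sq_le ?_
  rw [mul_pow, Real.sq_sqrt (N.rho_nonneg hP h r), rho, ← mul_div_assoc, div_le_div_iff₀
    (by positivity) hp]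
  nlinarith [mul_pos this hp, mul_nonneg (mul_nonneg (sq_nonneg ‖(h r).1‖) this.le) hP.le]

/-- A single deaf relay in the support of `x` amplifies enough noise to keep the signal-to-noise
ratio of `x` bounded, uniformly in the power level. -/
theorem exists_snr_le_on_deafRelays {T : Finset (Fin R)} {x : Fin R → ℂ}
    (hx : ∀ r, ‖x r‖ ≤ 1) (hT : x ≠ 0 → ∃ r ∈ T, x r ≠ 0) :
    ∃ K : ℝ, ∀ P : ℝ, 0 < P → ∀ h ∈ N.deafRelays T P, N.snr P x h ≤ K := by
  by_cases h0 : x = 0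
  · exact ⟨0, fun P _ h _ => by simp [snr, h0]⟩
  obtain ⟨s, hsT, hs⟩ := hT h0
  have hp := N.p₀_pos
  have hps := N.p_pos s
  have hxs : 0 < ‖x s‖ := norm_pos_iff.2 hs
  set B : ℝ := ∑ r, 2 * Real.sqrt (N.p r / N.p₀)
  refine ⟨N.p₀ * B ^ 2 / (‖x s‖ ^ 2 * (N.p s / 2)), fun P hP h hh => ?_⟩
  have hmem r : (r ∈ T → ‖(h r).1‖ ^ 2 * (N.p₀ * P) ≤ 1) ∧ 1 ≤ ‖(h r).2‖ ∧ ‖(h r).2‖ ≤ 2 :=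
    hh r (Set.mem_univ r)
  have hnum : ‖∑ r, x r * (h r).1 * (h r).2 * (Real.sqrt (N.rho P h r) : ℂ)‖ ≤ B := by
    refine norm_sum_le_of_le _ fun r _ => ?_
    rw [norm_mul, norm_mul, norm_mul, Complex.norm_real, Real.norm_of_nonneg (Real.sqrt_nonneg _)]
    calc ‖x r‖ * ‖(h r).1‖ * ‖(h r).2‖ * Real.sqrt (N.rho P h r)
        = ‖x r‖ * (‖(h r).2‖ * (‖(h r).1‖ * Real.sqrt (N.rho P h r))) := by ring
      _ ≤ 1 * (2 * Real.sqrt (N.p r / N.p₀)) := by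
        gcongr
        exacts [hx r, (hmem r).2.2, N.norm_mul_sqrt_rho_le hP h r]
      _ = 2 * Real.sqrt (N.p r / N.p₀) := one_mul _
  -- Deafness of `s` gives `1 + ‖f‖² P₀ ≤ 2`.
  have hrho : N.p s / 2 * P ≤ N.rho P h s := by
    rw [rho, le_div_iff₀ (by positivity)]
    nlinarith [(hmem s).1 hsT, mul_pos hps hP]
  have hden : ‖x s‖ ^ 2 * (N.p s / 2) * P ≤
      1 + ∑ r, ‖x r‖ ^ 2 * ‖(h r).2‖ ^ 2 * N.rho P h r := by
    have hsingle := Finset.single_le_sum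
      (f := fun r => ‖x r‖ ^ 2 * ‖(h r).2‖ ^ 2 * N.rho P h r)
      (fun r _ => mul_nonneg (by positivity) (N.rho_nonneg hP h r)) (Finset.mem_univ s)
    have hg : 1 ≤ ‖(h s).2‖ ^ 2 := one_le_pow₀ (hmem s).2.1
    calc ‖x s‖ ^ 2 * (N.p s / 2) * P = ‖x s‖ ^ 2 * 1 * (N.p s / 2 * P) := by ring
      _ ≤ ‖x s‖ ^ 2 * ‖(h s).2‖ ^ 2 * N.rho P h s := by gcongr
      _ ≤ _ := hsingle.trans (by linarith)
  calc N.snr P x h ≤ N.p₀ * P * B ^ 2 / (‖x s‖ ^ 2 * (N.p s / 2) * P) := by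
        unfold snr
        gcongr
    _ = _ := by field_simp

theorem measurable_snr (P : ℝ) (x : Fin R → ℂ) : Measurable (N.snr P x) := by
  unfold snr rho
  fun_prop

/-- The quantizer comes from an arbitrary choice among maximizers; its SNR is a finite maximum,
which yields measurability without any regularity of that choice. -/
theorem snr_optimalQuantizer_eq_sup' (C : ICodebook R) (P : ℝ) (h : ChannelState R) :
    N.snr P (N.optimalQuantizer C P h) h =
      C.vectors.sup' C.nonempty fun x => N.snr P x h :=
  le_antisymm (Finset.le_sup' (fun x => N.snr P x h) (N.optimalQuantizer_mem C P h))
    (Finset.sup'_le _ _ (N.snr_le_snr_optimalQuantizer C P h))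

theorem measurable_snr_optimalQuantizer (C : ICodebook R) (P : ℝ) :
    Measurable fun h => N.snr P (N.optimalQuantizer C P h) h := by
  have hsup := Finset.measurable_sup' C.nonempty fun x _ => N.measurable_snr P x
  convert hsup using 1
  ext h
  rw [snr_optimalQuantizer_eq_sup', Finset.sup'_apply]

theorem integrable_errorProbability (C : ICodebook R) (P : ℝ) :
    Integrable (fun h => gaussianTail (Real.sqrt (2 * N.snr P (N.optimalQuantizer C P h) h)))
      N.channelLaw := by
  refine Integrable.of_bound (C := 1) (Measurable.aestronglyMeasurable ?_)
    (Eventually.of_forall fun h => ?_)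
  · exact gaussianTail_antitone.measurable.comp
      ((N.measurable_snr_optimalQuantizer C P).const_mul 2).sqrt
  · rw [gaussianTail, Real.norm_of_nonneg measureReal_nonneg]
    exact measureReal_le_one

/-- A set of relays meeting the support of every nonzero codeword bounds the decay of the symbol
error rate from below. -/
theorem ser_ge_of_hitting_set (C : ICodebook R) {T : Finset (Fin R)}
    (hT : ∀ z ∈ C.vectors, z ≠ 0 → ∃ r ∈ T, z r ≠ 0) :
    ∃ c : ℝ, 0 < c ∧ ∀ P : ℝ, 1 ≤ N.p₀ * P →
      c * P⁻¹ ^ T.card ≤ N.ser P (N.optimalQuantizer C P) := by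
  obtain ⟨c, hc, hprob⟩ := N.channelLaw_real_deafRelays_ge T
  choose! K hK using fun x (hx : x ∈ C.vectors) =>
    N.exists_snr_le_on_deafRelays (C.norm_le_one x hx) (hT x hx)
  set L := C.vectors.sup' C.nonempty K
  refine ⟨gaussianTail (Real.sqrt (2 * L)) * c, mul_pos (gaussianTail_pos _) hc, fun P hP => ?_⟩
  have hP0 : 0 < P := pos_of_mul_pos_right (by linarith) N.p₀_pos.le
  calc gaussianTail (Real.sqrt (2 * L)) * c * P⁻¹ ^ T.card
      ≤ gaussianTail (Real.sqrt (2 * L)) * N.channelLaw.real (N.deafRelays T P) := by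
        rw [mul_assoc]
        exact mul_le_mul_of_nonneg_left (hprob P hP) (gaussianTail_pos _).le
    _ ≤ ∫ h in N.deafRelays T P,
          gaussianTail (Real.sqrt (2 * N.snr P (N.optimalQuantizer C P h) h)) ∂N.channelLaw := by
        refine setIntegral_ge_of_const_le_real (N.measurableSet_deafRelays T P)
          (measure_ne_top _ _) (fun h hh => gaussianTail_antitone (Real.sqrt_le_sqrt ?_))
          (N.integrable_errorProbability C P).integrableOn
        have hmem := N.optimalQuantizer_mem C P h
        have := (hK _ hmem P hP0 h hh).trans (Finset.le_sup' K hmem)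
        linarith
    _ ≤ N.ser P (N.optimalQuantizer C P) :=
        setIntegral_le_integral (N.integrable_errorProbability C P)
          (Eventually.of_forall fun _ => measureReal_nonneg)

theorem HasDiversity.le_of_hitting_set {N : RelayNetwork R} {C : ICodebook R} {d : ℝ}
    (hd : N.HasDiversity C d) {T : Finset (Fin R)}
    (hT : ∀ z ∈ C.vectors, z ≠ 0 → ∃ r ∈ T, z r ≠ 0) : d ≤ T.card := by
  obtain ⟨c, hc, hser⟩ := N.ser_ge_of_hitting_set C hT
  -- The constant `c` disappears on the logarithmic scale, leaving only the exponent.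
  have hlim : Tendsto (fun P : ℝ => -Real.log c / Real.log P + T.card) atTop (𝓝 (0 + T.card)) :=
    (Real.tendsto_log_atTop.const_div_atTop _).add_const _
  rw [zero_add] at hlim
  refine le_of_tendsto_of_tendsto hd hlim ?_
  filter_upwards [eventually_gt_atTop 1, eventually_ge_atTop N.p₀⁻¹] with P hP1 hP2
  have hP0 : 0 < P := by linarith
  have hlog : 0 < Real.log P := Real.log_pos hP1
  have hle := Real.log_le_log (by positivity)
    (hser P (by rwa [← inv_le_iff_one_le_mul₀' N.p₀_pos]))
  rw [Real.log_mul hc.ne' (by positivity), Real.log_pow, Real.log_inv] at hle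
  rw [div_add' _ _ _ hlog.ne']
  gcongr
  linarith

end RelayNetwork

theorem theorem5 {R : ℕ} (N : RelayNetwork R) (C : ICodebook R) (hcard : C.card ≤ R)
    (hdiv : N.HasDiversity C (C.card : ℝ)) : C.IsOMRS := by
  intro x hx y hy hxy
  refine Finset.sum_eq_zero fun r _ => ?_
  by_contra hr
  obtain ⟨T, hTcard, hT⟩ := C.exists_hitting_set hx hy hxy
    (norm_ne_zero_iff.1 (left_ne_zero_of_mul hr)) (norm_ne_zero_iff.1 (right_ne_zero_of_mul hr))
  exact absurd (Nat.cast_le.1 (hdiv.le_of_hitting_set hT)) hTcard.not_ge
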